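/- **Conventions.** Let $G$ be a free abelian group of finite rank and $G^{\star}=\mathrm{Hom}(G,\mathbb{Z})$. A *convex cone* in $G$ is a finitely generated submonoid $P\subseteq G$ which is saturated (if $x$ lies in the subgroup $P^{\mathrm{gp}}$ generated by $P$ and $nx\in P$ for some integer $n\geq 1$, then $x\in P$), whose only invertible element is $0$, and such that $G/P^{\mathrm{gp}}$ is torsion free. A *prime ideal* of $P$ is a (possibly empty) subset $\mathfrak{p}\subseteq P$ with $P+\mathfrak{p}\subseteq\mathfrak{p}$ whose complement $P-\mathfrak{p}$ is a submonoid of $P$. A *fan* in $G$ is a nonempty (possibly infinite) set $\triangle$ of convex cones in $G$ such that (1) $P-\mathfrak{p}\in\triangle$ for every $P\in\triangle$ and every prime ideal $\mathfrak{p}$ of $P$; (2) for all $P,Q\in\triangle$ there are prime ideals $\mathfrak{p}$ of $P$ and $\mathfrak{q}$ of $Q$ with $P\cap Q=P-\mathfrak{p}=Q-\mathfrak{q}$. For a field $k$ and $P\in\triangle$ put $\check{P}=\{\sigma\in G^{\star} : \sigma(x)\geq 0 \text{ for all } x\in P\}$ and $U_P=\mathrm{Spec}\,k[\check{P}]$.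 For $Q\subseteq P$ in $\triangle$ the inclusion $\check P\subseteq\check Q$ induces an open immersion $U_Q\to U_P$, and the toric scheme $X_{\triangle}(k)$ is obtained by gluing the $U_P$ $(P\in\triangle)$ along the $U_{P\cap Q}$. A *homomorphism of fans* $\varphi\colon(G,\triangle)\to(G',\triangle')$ is a group homomorphism $\varphi\colon G\to G'$ such that every $P\in\triangle$ satisfies $\varphi(P)\subseteq P'$ for some $P'\in\triangle'$. It induces a morphism of schemes $\varphi_{\ast}\colon X_{\triangle}(k)\to X_{\triangle'}(k)$, given on $U_P$, whenever $\varphi(P)\subseteq P'$, by the morphism $U_P\to U_{P'}$ coming from $\check{P'}\to\check{P}$, $\sigma\mapsto\sigma\circ\varphi$. A morphism of schemes $X\to Y$ is *birational* if it restricts to an isomorphism from a dense open subscheme of $X$ onto a dense open subscheme of $Y$. **Theorem.** Let $k$ be a field, let $G,G'$ be free abelian groups of finite rank with fans $\triangle,\triangle'$, and let $\varphi\colon(G,\triangle)\to(G',\triangle')$ be a homomorphism of fans. Then $\varphi_{\ast}\colon X_{\triangle}(k)\to X_{\triangle'}(k)$ is birational if and only if $\varphi\colon G\to G'$ is an isomorphism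 of groups. -/

import Mathlib

open CategoryTheory CategoryTheory.Limits AlgebraicGeometry

universe u

noncomputable section

namespace Toric

/-! ### Convex cones, prime ideals and fans -/

section Cones

variable {G : Type u} [AddCommGroup G]

/-- A convex cone in a free abelian group `G` of finite rank: a finitely generated saturated
submonoid `P` of `G` with no nonzero unit, such that the quotient of `G` by the subgroup generated
by `P` (which is the Grothendieck group of `P`) is torsion free. -/
structure IsConvexCone (P : AddSubmonoid G) : Prop where
  fg : P.FG
  saturated : ∀ x ∈ AddSubgroup.closure (P : Set G), ∀ n : ℕ, 0 < n → n • x ∈ P → x ∈ P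
  sharp : ∀ x ∈ P, -x ∈ P → x = 0
  torsionFree : IsAddTorsionFree (G ⧸ AddSubgroup.closure (P : Set G))

/-- Prime ideals of the monoid `P`: subsets of `P`, possibly empty, that are stable under
translation by `P` and whose complement in `P` is a submonoid. -/
structure IsPrimeIdeal (P : AddSubmonoid G) (𝔭 : Set G) : Prop where
  subset : 𝔭 ⊆ P
  add_mem : ∀ x ∈ P, ∀ y ∈ 𝔭, x + y ∈ 𝔭
  zero_notMem : (0 : G) ∉ 𝔭
  mem_or_mem : ∀ x ∈ P, ∀ y ∈ P, x + y ∈ 𝔭 → x ∈ 𝔭 ∨ y ∈ 𝔭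

/-- `Q = P - 𝔭` for some prime ideal `𝔭` of the monoid `P`. -/
def IsFace (Q P : AddSubmonoid G) : Prop :=
  ∃ 𝔭 : Set G, IsPrimeIdeal P 𝔭 ∧ (Q : Set G) = (P : Set G) \ 𝔭

theorem IsFace.le {Q P : AddSubmonoid G} (h : IsFace Q P) : Q ≤ P := by
  obtain ⟨𝔭, -, h⟩ := h
  intro x hx
  have : x ∈ (Q : Set G) := hx
  rw [h] at this
  exact this.1

theorem IsFace.mem_of_add_mem {Q P : AddSubmonoid G} (h : IsFace Q P) {x y : G} (hx : x ∈ P)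
    (hy : y ∈ P) (hxy : x + y ∈ Q) : x ∈ Q := by
  obtain ⟨𝔭, h𝔭, h⟩ := h
  have h' : ∀ z, z ∈ Q ↔ z ∈ P ∧ z ∉ 𝔭 := fun z => by
    rw [← SetLike.mem_coe, h]; rfl
  rw [h'] at hxy ⊢
  refine ⟨hx, fun hx' => hxy.2 ?_⟩
  rw [add_comm]
  exact h𝔭.add_mem y hy x hx'

variable (G) in
/-- A fan in `G`. -/
structure Fan where
  cones : Set (AddSubmonoid G)
  nonempty : cones.Nonempty
  isConvexCone : ∀ P ∈ cones, IsConvexCone P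
  face_mem : ∀ P ∈ cones, ∀ Q, IsFace Q P → Q ∈ cones
  inter_isFace : ∀ P ∈ cones, ∀ Q ∈ cones, IsFace (P ⊓ Q) P ∧ IsFace (P ⊓ Q) Q

theorem Fan.inter_mem (Δ : Fan G) {P Q : AddSubmonoid G} (hP : P ∈ Δ.cones) (hQ : Q ∈ Δ.cones) :
    P ⊓ Q ∈ Δ.cones :=
  Δ.face_mem P hP _ (Δ.inter_isFace P hP Q hQ).1

theorem Fan.isFace_of_le (Δ : Fan G) {P Q : AddSubmonoid G} (hP : P ∈ Δ.cones) (hQ : Q ∈ Δ.cones)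
    (h : Q ≤ P) : IsFace Q P := by
  have := (Δ.inter_isFace P hP Q hQ).1
  rwa [inf_eq_right.mpr h] at this

/-- A homomorphism of fans `(G, Δ) → (G', Δ')`. -/
structure FanHom {G' : Type u} [AddCommGroup G'] (Δ : Fan G) (Δ' : Fan G') where
  toAddMonoidHom : G →+ G'
  exists_map_le : ∀ P ∈ Δ.cones, ∃ P' ∈ Δ'.cones, P.map toAddMonoidHom ≤ P'

/-- The dual cone `{σ ∈ Hom(G, ℤ) | σ ≥ 0 on P}`, as a monoid. -/
def dualCone (P : AddSubmonoid G) : AddSubmonoid (Module.Dual ℤ G) where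
  carrier := {σ | ∀ x ∈ P, 0 ≤ σ x}
  zero_mem' := fun _ _ => le_rfl
  add_mem' := fun ha hb x hx => add_nonneg (ha x hx) (hb x hx)

theorem mem_dualCone {P : AddSubmonoid G} {σ : Module.Dual ℤ G} :
    σ ∈ dualCone P ↔ ∀ x ∈ P, 0 ≤ σ x := Iff.rfl

/-- If `φ(P) ⊆ P'`, then `σ ↦ σ ∘ φ` maps the dual cone of `P'` to that of `P`. -/
def dualConeMap {G' : Type u} [AddCommGroup G'] (φ : G →+ G') {P : AddSubmonoid G}
    {P' : AddSubmonoid G'} (h : P.map φ ≤ P') : dualCone P' →+ dualCone P where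
  toFun σ := ⟨(σ : Module.Dual ℤ G').comp φ.toIntLinearMap,
    fun x hx => σ.2 (φ x) (h (AddSubmonoid.mem_map_of_mem φ hx))⟩
  map_zero' := rfl
  map_add' _ _ := rfl

end Cones

/-! ### Faces are cut out by elements of the dual cone -/

section Separation

/-- An integral version of the Farkas lemma. -/
theorem exists_eq_sum_of_nonpos {H ι : Type*} [AddCommGroup H] [DecidableEq ι] (s : Finset ι)
    (a : ι → H →+ ℤ) (b : H →+ ℤ) (hb : ∀ x, (∀ i ∈ s, a i x ≤ 0) → b x ≤ 0) :
    ∃ N : ℕ, 0 < N ∧ ∃ c : ι → ℕ, N • b = ∑ i ∈ s, c i • a i := by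
  induction s using Finset.induction_on generalizing a b with
  | empty =>
    refine ⟨1, one_pos, 0, ?_⟩
    ext x
    have h1 := hb x (by simp)
    have h2 := hb (-x) (by simp)
    rw [map_neg] at h2
    simp
    lia
  | insert j s hj ih =>
    by_cases hs : ∀ x, (∀ i ∈ s, a i x ≤ 0) → b x ≤ 0
    · obtain ⟨N, hN, c, hc⟩ := ih a b hs
      refine ⟨N, hN, Function.update c j 0, ?_⟩
      rw [hc, Finset.sum_insert hj]
      simp only [Function.update_self, zero_smul, zero_add]
      refine Finset.sum_congr rfl fun i hi => ?_
      rw [Function.update_of_ne (by rintro rfl; exact hj hi)]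
    · push Not at hs
      obtain ⟨y, hy, hby⟩ := hs
      have hjy : 0 < a j y := by
        by_contra h
        refine absurd (hb y ?_) (not_le.mpr hby)
        intro i hi
        rcases Finset.mem_insert.mp hi with rfl | hi
        · exact not_lt.mp h
        · exact hy i hi
      let p : H →+ H :=
        { toFun := fun x => a j y • x - a j x • y
          map_zero' := by simp
          map_add' := fun x z => by simp only [map_add, smul_add, add_smul]; abel }
      have hp : ∀ (f : H →+ ℤ) (x : H), f (p x) = a j y * f x - a j x * f y := fun f x => by
        simp [p]
      obtain ⟨N, hN, c, hc⟩ := ih (fun i => (a i).comp p) (b.comp p) (by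
        intro x hx
        refine hb (p x) fun i hi => ?_
        rcases Finset.mem_insert.mp hi with rfl | hi
        · rw [hp]; apply le_of_eq; ring
        · exact hx i hi)
      have hpos : 0 ≤ N * b y - ∑ i ∈ s, c i * a i y := by
        have : ∑ i ∈ s, (c i : ℤ) * a i y ≤ 0 :=
          Finset.sum_nonpos fun i hi => mul_nonpos_of_nonneg_of_nonpos (by positivity) (hy i hi)
        have : (0 : ℤ) ≤ N * b y := by positivity
        lia
      refine ⟨N * (a j y).toNat, Nat.mul_pos hN (by lia),
        Function.update (fun i => c i * (a j y).toNat) j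
          (N * b y - ∑ i ∈ s, c i * a i y).toNat, ?_⟩
      have hupd : ∀ m : ℕ, ∑ i ∈ s, Function.update (fun i => c i * (a j y).toNat) j m i • a i =
          ∑ i ∈ s, (c i * (a j y).toNat) • a i := fun m =>
        Finset.sum_congr rfl fun i hi => by
          rw [Function.update_of_ne (by rintro rfl; exact hj hi : i ≠ j)]
      rw [Finset.sum_insert hj, hupd, Function.update_self]
      ext x
      have key := DFunLike.congr_fun hc x
      simp only [AddMonoidHom.coe_smul, Pi.smul_apply, AddMonoidHom.add_apply,
        AddMonoidHom.finsetSum_apply, nsmul_eq_mul, AddMonoidHom.comp_apply, hp, Nat.cast_mul,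
        Int.toNat_of_nonneg hpos, Int.toNat_of_nonneg hjy.le] at key ⊢
      simp only [mul_sub, sub_mul, Finset.sum_sub_distrib, Finset.sum_mul] at key ⊢
      have e1 : ∑ i ∈ s, (c i : ℤ) * (a j y * a i x) = ∑ i ∈ s, c i * a j y * a i x :=
        Finset.sum_congr rfl fun i _ => by ring
      have e2 : ∑ i ∈ s, (c i : ℤ) * (a j x * a i y) = ∑ i ∈ s, c i * a i y * a j x :=
        Finset.sum_congr rfl fun i _ => by ring
      rw [e1, e2] at key
      linarith

variable {G : Type u} [AddCommGroup G]

theorem exists_dualCone_pos [Module.Free ℤ G] {P Q : AddSubmonoid G} (hPQ : IsFace Q P) (s : Finset G)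
    (hs : AddSubmonoid.closure (s : Set G) = P) {x : G} (hxP : x ∈ P) (hxQ : x ∉ Q) :
    ∃ τ : Module.Dual ℤ G, (∀ y ∈ P, 0 ≤ τ y) ∧ (∀ y ∈ Q, τ y = 0) ∧ 0 < τ x := by
  classical
  have hsP : ∀ y ∈ s, y ∈ P := fun y hy => hs ▸ AddSubmonoid.subset_closure hy
  by_contra hcon
  push Not at hcon
  let ev : G →+ (Module.Dual ℤ G →+ ℤ) :=
    { toFun := fun y =>
        { toFun := fun τ => τ y
          map_zero' := rfl
          map_add' := fun _ _ => rfl }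
      map_zero' := by ext; simp
      map_add' := fun _ _ => by ext; simp }
  have hev : ∀ y τ, ev y τ = τ y := fun _ _ => rfl
  have hinj : Function.Injective ev := fun y z h =>
    Module.eval_apply_injective ℤ (LinearMap.ext fun τ => DFunLike.congr_fun h τ)
  obtain ⟨N, hN, c, hc⟩ := exists_eq_sum_of_nonpos (H := Module.Dual ℤ G)
    (s.disjSum (s.filter (· ∈ Q))) (Sum.elim (fun y => - ev y) ev) (ev x) (by
      intro τ hτ
      have h1 : ∀ y ∈ P, 0 ≤ τ y := by
        intro y hy
        rw [← hs] at hy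
        induction hy using AddSubmonoid.closure_induction with
        | mem y hy =>
          have := hτ (Sum.inl y) (by simpa using hy)
          simpa [hev] using this
        | zero => simp
        | add y z _ _ hy hz => rw [map_add]; exact add_nonneg hy hz
      have h2 : ∀ y ∈ P, y ∈ Q → τ y ≤ 0 := by
        intro y hy
        rw [← hs] at hy
        induction hy using AddSubmonoid.closure_induction with
        | mem y hy =>
          intro hyQ
          have := hτ (Sum.inr y) (by simpa [hyQ] using hy)
          simpa [hev] using this
        | zero => simp
        | add y z hy' hz' hy hz =>
          intro hyz
          rw [hs] at hy' hz'
          rw [map_add]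
          exact add_nonpos (hy (hPQ.mem_of_add_mem hy' hz' hyz))
            (hz (hPQ.mem_of_add_mem hz' hy' (add_comm y z ▸ hyz)))
      exact hcon τ h1 fun y hy => le_antisymm (h2 y (hPQ.le hy) hy) (h1 y (hPQ.le hy)))
  rw [Finset.sum_disjSum] at hc
  simp only [Sum.elim_inl, Sum.elim_inr, smul_neg, Finset.sum_neg_distrib, ← map_nsmul,
    ← map_sum, ← map_neg, ← map_add] at hc
  have hc := hinj hc
  set p := ∑ i ∈ s, c (Sum.inl i) • i
  set q := ∑ i ∈ s.filter (· ∈ Q), c (Sum.inr i) • i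
  have hp : p ∈ P := sum_mem fun i hi => nsmul_mem (hsP i hi) _
  have hq : q ∈ Q := sum_mem fun i hi => nsmul_mem (Finset.mem_filter.mp hi).2 _
  have hNx : N • x ∈ Q := by
    refine hPQ.mem_of_add_mem (nsmul_mem hxP N) hp ?_
    rw [hc]
    simpa using hq
  obtain ⟨n, rfl⟩ := Nat.exists_eq_succ_of_ne_zero hN.ne'
  rw [Nat.succ_eq_add_one, succ_nsmul'] at hNx
  exact hxQ (hPQ.mem_of_add_mem hxP (nsmul_mem hxP n) hNx)

/-- `τ` is nonnegative on `P` and `Q` is its zero locus in `P`. -/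
def Cuts (P Q : AddSubmonoid G) (τ : Module.Dual ℤ G) : Prop :=
  τ ∈ dualCone P ∧ ∀ y ∈ P, τ y = 0 ↔ y ∈ Q

theorem exists_cuts [Module.Free ℤ G] {P Q : AddSubmonoid G} (hP : P.FG) (hPQ : IsFace Q P) :
    ∃ τ, Cuts P Q τ := by
  classical
  obtain ⟨s, hs⟩ := hP
  have hsP : ∀ y ∈ s, y ∈ P := fun y hy => hs ▸ AddSubmonoid.subset_closure hy
  have H : ∀ x : G, ∃ τ : Module.Dual ℤ G, (∀ y ∈ P, 0 ≤ τ y) ∧ (∀ y ∈ Q, τ y = 0) ∧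
      (x ∈ P → x ∉ Q → 0 < τ x) := fun x => by
    by_cases hx : x ∈ P ∧ x ∉ Q
    · obtain ⟨τ, h1, h2, h3⟩ := exists_dualCone_pos hPQ s hs hx.1 hx.2
      exact ⟨τ, h1, h2, fun _ _ => h3⟩
    · exact ⟨0, by simp, by simp, fun h1 h2 => absurd ⟨h1, h2⟩ hx⟩
  choose t ht1 ht2 ht3 using H
  have hmem : ∑ x ∈ s, t x ∈ dualCone P := sum_mem fun x _ => ht1 x
  refine ⟨∑ x ∈ s, t x, hmem, fun y hy => ⟨?_, fun hy => ?_⟩⟩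
  · rw [← hs] at hy
    induction hy using AddSubmonoid.closure_induction with
    | zero => exact fun _ => Q.zero_mem
    | add y z hy' hz' hy hz =>
      rw [hs] at hy' hz'
      intro h
      rw [map_add] at h
      have h1 := hmem y hy'
      have h2 := hmem z hz'
      exact Q.add_mem (hy (by lia)) (hz (by lia))
    | mem y hy =>
      intro h
      by_contra hyQ
      have hy : y ∈ s := hy
      have h1 : 0 < t y y := ht3 y (hsP y hy) hyQ
      rw [LinearMap.sum_apply, Finset.sum_eq_zero_iff_of_nonneg fun x _ => ht1 x y (hsP y hy)] at h
      exact h1.ne' (h y hy)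
  · rw [LinearMap.sum_apply]
    exact Finset.sum_eq_zero fun x _ => ht2 x y hy

theorem Cuts.exists_add_nsmul_mem {P Q : AddSubmonoid G} {τ : Module.Dual ℤ G} (hP : P.FG)
    (h : Cuts P Q τ) {σ : Module.Dual ℤ G} (hσ : σ ∈ dualCone Q) :
    ∃ n : ℕ, σ + n • τ ∈ dualCone P := by
  obtain ⟨s, hs⟩ := hP
  have hsP : ∀ y ∈ s, y ∈ P := fun y hy => hs ▸ AddSubmonoid.subset_closure hy
  refine ⟨∑ x ∈ s, (σ x).natAbs, fun y hy => ?_⟩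
  rw [← hs] at hy
  induction hy using AddSubmonoid.closure_induction with
  | zero => simp
  | add y z _ _ hy hz => rw [map_add]; exact add_nonneg hy hz
  | mem y hy =>
    have hy : y ∈ s := hy
    rw [LinearMap.add_apply, LinearMap.smul_apply, nsmul_eq_mul]
    have h0 : 0 ≤ τ y := h.1 y (hsP y hy)
    by_cases hyQ : y ∈ Q
    · have := hσ y hyQ
      positivity
    · have h1 : τ y ≠ 0 := fun h' => hyQ ((h.2 y (hsP y hy)).mp h')
      have h2 : 1 ≤ τ y := by lia
      have h3 : (σ y).natAbs ≤ ∑ x ∈ s, (σ x).natAbs :=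
        Finset.single_le_sum (f := fun x => (σ x).natAbs) (fun x _ => Nat.zero_le _) hy
      have h4 : -σ y ≤ ((∑ x ∈ s, (σ x).natAbs : ℕ) : ℤ) := by lia
      nlinarith

theorem Cuts.add {P Q Q' : AddSubmonoid G} {τ τ' : Module.Dual ℤ G} (h : Cuts P Q τ)
    (h' : Cuts P Q' τ') : Cuts P (Q ⊓ Q') (τ + τ') := by
  refine ⟨add_mem h.1 h'.1, fun y hy => ?_⟩
  rw [AddSubmonoid.mem_inf, ← h.2 y hy, ← h'.2 y hy, LinearMap.add_apply]
  have h1 := h.1 y hy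
  have h2 := h'.1 y hy
  lia

end Separation

/-! ### Affine charts -/

section Charts

variable {G G' G'' : Type u} [AddCommGroup G] [AddCommGroup G'] [AddCommGroup G'']
variable (R : Type u) [CommRing R]

/-- The affine scheme `U_P = Spec R[P̌]`, where `P̌` is the dual cone of `P`. -/
abbrev chart (P : AddSubmonoid G) : Scheme.{u} :=
  Spec (CommRingCat.of (AddMonoidAlgebra R (dualCone P)))

/-- If `φ(P) ⊆ P'`, the morphism `U_P ⟶ U_{P'}` induced by the homomorphism `σ ↦ σ ∘ φ` of dual
cones. -/
def chartMap (φ : G →+ G') {P : AddSubmonoid G} {P' : AddSubmonoid G'} (h : P.map φ ≤ P') :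
    chart R P ⟶ chart R P' :=
  Spec.map (CommRingCat.ofHom (AddMonoidAlgebra.mapDomainRingHom R (dualConeMap φ h)))

theorem chartMap_comp (φ : G →+ G') (ψ : G' →+ G'') {χ : G →+ G''} (hχ : χ = ψ.comp φ)
    {P : AddSubmonoid G} {P' : AddSubmonoid G'} {P'' : AddSubmonoid G''}
    (h : P.map φ ≤ P') (h' : P'.map ψ ≤ P'') (h'' : P.map χ ≤ P'') :
    chartMap R φ h ≫ chartMap R ψ h' = chartMap R χ h'' := by
  subst hχ
  rw [chartMap, chartMap, chartMap, ← Spec.map_comp, ← CommRingCat.ofHom_comp,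
    ← AddMonoidAlgebra.mapDomainRingHom_comp]
  rfl

theorem map_id_le {P Q : AddSubmonoid G} (h : P ≤ Q) : P.map (AddMonoidHom.id G) ≤ Q := by
  rwa [AddSubmonoid.map_id]

theorem chartMap_id (P : AddSubmonoid G) :
    chartMap R (AddMonoidHom.id G) (map_id_le (le_refl P)) = 𝟙 (chart R P) := by
  have : dualConeMap (AddMonoidHom.id G) (map_id_le (le_refl P)) = AddMonoidHom.id _ := rfl
  rw [chartMap, this, AddMonoidAlgebra.mapDomainRingHom_id]
  exact Spec.map_id _

/-- For `P ⊆ Q`, the morphism `U_P ⟶ U_Q` given by the inclusion of dual cones. -/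
abbrev chartInclusion {P Q : AddSubmonoid G} (h : P ≤ Q) : chart R P ⟶ chart R Q :=
  chartMap R (AddMonoidHom.id G) (map_id_le h)

variable {R}

theorem isLocalization_of_cuts {P Q : AddSubmonoid G} (hP : P.FG) (hQ : Q ≤ P)
    {τ : Module.Dual ℤ G} (hτ : Cuts P Q τ) :
    @IsLocalization.Away _ _ (AddMonoidAlgebra.single (⟨τ, hτ.1⟩ : dualCone P) (1 : R))
      (AddMonoidAlgebra R (dualCone Q)) _
      (AddMonoidAlgebra.mapDomainRingHom R
        (dualConeMap (AddMonoidHom.id G) (map_id_le hQ))).toAlgebra := by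
  let _ := (AddMonoidAlgebra.mapDomainRingHom R
        (dualConeMap (AddMonoidHom.id G) (map_id_le hQ))).toAlgebra
  set ι := dualConeMap (AddMonoidHom.id G) (map_id_le hQ) with hι
  have hιinj : Function.Injective ι := fun a b hab => by
    apply Subtype.ext
    exact congrArg (Subtype.val : dualCone Q → Module.Dual ℤ G) hab
  have halg : ∀ x, algebraMap (AddMonoidAlgebra R (dualCone P)) (AddMonoidAlgebra R (dualCone Q)) x
      = AddMonoidAlgebra.mapDomainRingHom R ι x := fun _ => rfl
  have hpow : ∀ n : ℕ, (AddMonoidAlgebra.single (⟨τ, hτ.1⟩ : dualCone P) (1 : R)) ^ n =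
      AddMonoidAlgebra.single (n • (⟨τ, hτ.1⟩ : dualCone P)) (1 : R) := fun n => by
    rw [AddMonoidAlgebra.single_pow, one_pow]
  have hneg : -τ ∈ dualCone Q := fun y hy => by
    rw [LinearMap.neg_apply, (hτ.2 y (hQ hy)).mpr hy, neg_zero]
  have hunit : IsUnit (algebraMap (AddMonoidAlgebra R (dualCone P))
      (AddMonoidAlgebra R (dualCone Q)) (AddMonoidAlgebra.single (⟨τ, hτ.1⟩ : dualCone P) 1)) := by
    refine IsUnit.of_mul_eq_one (AddMonoidAlgebra.single (⟨-τ, hneg⟩ : dualCone Q) 1) ?_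
    have : ι ⟨τ, hτ.1⟩ + ⟨-τ, hneg⟩ = 0 := by
      apply Subtype.ext
      exact add_neg_cancel τ
    rw [halg, AddMonoidAlgebra.mapDomainRingHom_apply, AddMonoidAlgebra.mapDomain_single,
      AddMonoidAlgebra.single_mul_single, this, mul_one, AddMonoidAlgebra.one_def]
  have hsurj : ∀ z : AddMonoidAlgebra R (dualCone Q), ∃ n : ℕ, ∃ a : AddMonoidAlgebra R (dualCone P),
      z * algebraMap _ _ (AddMonoidAlgebra.single (⟨τ, hτ.1⟩ : dualCone P) (1 : R) ^ n) =
        algebraMap _ _ a := by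
    intro z
    induction z using AddMonoidAlgebra.induction_linear with
    | zero => exact ⟨0, 0, by simp⟩
    | add f g hf hg =>
      obtain ⟨n, a, ha⟩ := hf
      obtain ⟨m, b, hb⟩ := hg
      refine ⟨n + m, a * AddMonoidAlgebra.single (⟨τ, hτ.1⟩ : dualCone P) (1 : R) ^ m +
        b * AddMonoidAlgebra.single (⟨τ, hτ.1⟩ : dualCone P) (1 : R) ^ n, ?_⟩
      rw [map_add, map_mul, map_mul, ← ha, ← hb, pow_add, map_mul]
      ring
    | single σ r =>
      obtain ⟨n, hn⟩ := hτ.exists_add_nsmul_mem hP σ.2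
      refine ⟨n, AddMonoidAlgebra.single ⟨_, hn⟩ r, ?_⟩
      rw [hpow, halg, halg, AddMonoidAlgebra.mapDomainRingHom_apply,
        AddMonoidAlgebra.mapDomainRingHom_apply, AddMonoidAlgebra.mapDomain_single,
        AddMonoidAlgebra.mapDomain_single, AddMonoidAlgebra.single_mul_single, mul_one]
      congr 1
  refine ⟨?_, ?_, ?_⟩
  · rintro ⟨_, n, rfl⟩
    simpa only [map_pow] using hunit.pow n
  · intro z
    obtain ⟨n, a, ha⟩ := hsurj z
    exact ⟨(a, ⟨_, n, rfl⟩), ha⟩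
  · intro x y hxy
    refine ⟨1, ?_⟩
    rw [AddMonoidAlgebra.mapDomain_injective hιinj hxy]

theorem isOpenImmersion_chartInclusion [Module.Free ℤ G] {P Q : AddSubmonoid G} (hP : P.FG)
    (hQ : IsFace Q P) : IsOpenImmersion (chartInclusion R hQ.le) := by
  obtain ⟨τ, hτ⟩ := exists_cuts hP hQ
  let _ := (AddMonoidAlgebra.mapDomainRingHom R
        (dualConeMap (AddMonoidHom.id G) (map_id_le hQ.le))).toAlgebra
  have := isLocalization_of_cuts (R := R) hP hQ.le hτ
  exact IsOpenImmersion.of_isLocalization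
    (AddMonoidAlgebra.single (⟨τ, hτ.1⟩ : dualCone P) (1 : R))

theorem range_chartInclusion {P Q : AddSubmonoid G} (hP : P.FG) (hQ : Q ≤ P)
    {τ : Module.Dual ℤ G} (hτ : Cuts P Q τ) :
    Set.range (chartInclusion R hQ) =
      (PrimeSpectrum.basicOpen (AddMonoidAlgebra.single (⟨τ, hτ.1⟩ : dualCone P) (1 : R)) :
        Set (PrimeSpectrum (AddMonoidAlgebra R (dualCone P)))) := by
  let _ := (AddMonoidAlgebra.mapDomainRingHom R
        (dualConeMap (AddMonoidHom.id G) (map_id_le hQ))).toAlgebra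
  have := isLocalization_of_cuts (R := R) hP hQ hτ
  exact PrimeSpectrum.localization_away_comap_range (AddMonoidAlgebra R (dualCone Q))
    (AddMonoidAlgebra.single (⟨τ, hτ.1⟩ : dualCone P) (1 : R))

theorem range_inter_range [Module.Free ℤ G] {P Q Q' : AddSubmonoid G} (hP : P.FG)
    (hQ : IsFace Q P) (hQ' : IsFace Q' P) :
    Set.range (chartInclusion R hQ.le) ∩ Set.range (chartInclusion R hQ'.le) =
      Set.range (chartInclusion R (inf_le_left.trans hQ.le : Q ⊓ Q' ≤ P)) := by
  obtain ⟨τ, hτ⟩ := exists_cuts hP hQ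
  obtain ⟨τ', hτ'⟩ := exists_cuts hP hQ'
  rw [range_chartInclusion hP hQ.le hτ, range_chartInclusion hP hQ'.le hτ',
    range_chartInclusion hP _ (hτ.add hτ')]
  have : AddMonoidAlgebra.single (⟨τ + τ', (hτ.add hτ').1⟩ : dualCone P) (1 : R) =
      AddMonoidAlgebra.single (⟨τ, hτ.1⟩ : dualCone P) (1 : R) *
        AddMonoidAlgebra.single (⟨τ', hτ'.1⟩ : dualCone P) (1 : R) := by
    rw [AddMonoidAlgebra.single_mul_single, mul_one]
    rfl
  rw [this, PrimeSpectrum.basicOpen_mul]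
  rfl

end Charts

/-! ### Toric schemes and their morphisms -/

section ToricScheme

variable {G G' : Type u} [AddCommGroup G] [AddCommGroup G']
variable (R : Type u) [CommRing R]

/-- The diagram of the schemes `U_P`, for `P` in the fan ordered by inclusion. -/
def diagram (Δ : Fan G) : Δ.cones ⥤ Scheme.{u} where
  obj P := chart R P.1
  map f := chartInclusion R (leOfHom f)
  map_id P := chartMap_id R P.1
  map_comp f g := (chartMap_comp R _ _ rfl (map_id_le (leOfHom f)) (map_id_le (leOfHom g)) _).symm

instance isOpenImmersion_diagram_map [Module.Free ℤ G] (Δ : Fan G) {P Q : Δ.cones} (f : P ⟶ Q) :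
    IsOpenImmersion ((diagram R Δ).map f) :=
  isOpenImmersion_chartInclusion (Δ.isConvexCone Q.1 Q.2).fg
    (Δ.isFace_of_le Q.2 P.2 (leOfHom f))

instance isLocallyDirected_diagram [Module.Free ℤ G] (Δ : Fan G) :
    (diagram R Δ ⋙ Scheme.forget).IsLocallyDirected where
  cond {P Q S} f g x y hxy := by
    have hx : (chartInclusion R (leOfHom f)) x = (chartInclusion R (leOfHom g)) y := hxy
    have hS := (Δ.isConvexCone S.1 S.2).fg
    have hPS := Δ.isFace_of_le S.2 P.2 (leOfHom f)
    have hQS := Δ.isFace_of_le S.2 Q.2 (leOfHom g)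
    let T : Δ.cones := ⟨P.1 ⊓ Q.1, Δ.inter_mem P.2 Q.2⟩
    let tP : T ⟶ P := homOfLE (show P.1 ⊓ Q.1 ≤ P.1 from inf_le_left)
    let tQ : T ⟶ Q := homOfLE (show P.1 ⊓ Q.1 ≤ Q.1 from inf_le_right)
    obtain ⟨z, hz⟩ : chartInclusion R (leOfHom f) x ∈
        Set.range (chartInclusion R (inf_le_left.trans hPS.le : P.1 ⊓ Q.1 ≤ S.1)) := by
      rw [← range_inter_range hS hPS hQS]
      exact ⟨⟨x, rfl⟩, ⟨y, hx.symm⟩⟩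
    refine ⟨T, tP, tQ, z, ?_, ?_⟩
    · apply ((diagram R Δ).map f).isOpenEmbedding.injective
      have h1 : (diagram R Δ).map f ((diagram R Δ).map tP z) = (diagram R Δ).map (tP ≫ f) z := by
        rw [Functor.map_comp]; rfl
      exact h1.trans hz
    · apply ((diagram R Δ).map g).isOpenEmbedding.injective
      have h1 : (diagram R Δ).map g ((diagram R Δ).map tQ z) = (diagram R Δ).map (tQ ≫ g) z := by
        rw [Functor.map_comp]; rfl
      exact h1.trans (hz.trans hx)

/-- The toric scheme of the fan `Δ` over `R`, obtained by gluing the `U_P` along the open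
subschemes `U_{P ∩ Q}`. -/
def toricScheme [Module.Free ℤ G] (Δ : Fan G) : Scheme.{u} :=
  colimit (diagram R Δ)

/-- The open immersion of `U_P` into the toric scheme. -/
def chartι [Module.Free ℤ G] (Δ : Fan G) (P : Δ.cones) : chart R P.1 ⟶ toricScheme R Δ :=
  colimit.ι (diagram R Δ) P

theorem chartInclusion_chartι [Module.Free ℤ G] (Δ : Fan G) {P Q : Δ.cones} (h : P.1 ≤ Q.1) :
    chartInclusion R h ≫ chartι R Δ Q = chartι R Δ P :=
  colimit.w (diagram R Δ) (homOfLE h : P ⟶ Q)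

variable {R} in
theorem chartMap_chartι_eq [Module.Free ℤ G'] {Δ' : Fan G'} (φ : G →+ G') {P Q : AddSubmonoid G}
    (hPQ : P ≤ Q) {P' Q' : Δ'.cones} (hP : P.map φ ≤ P'.1) (hQ : Q.map φ ≤ Q'.1) :
    chartInclusion R hPQ ≫ chartMap R φ hQ ≫ chartι R Δ' Q' = chartMap R φ hP ≫ chartι R Δ' P' := by
  let T : Δ'.cones := ⟨P'.1 ⊓ Q'.1, Δ'.inter_mem P'.2 Q'.2⟩
  have hP' : P.map φ ≤ Q'.1 := by
    rintro _ ⟨x, hx, rfl⟩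
    exact hQ (AddSubmonoid.mem_map_of_mem φ (hPQ hx))
  have hT : P.map φ ≤ T.1 := le_inf hP hP'
  have hTP : T.1 ≤ P'.1 := inf_le_left
  have hTQ : T.1 ≤ Q'.1 := inf_le_right
  have e := (AddMonoidHom.id_comp φ).symm
  rw [← chartMap_comp R φ (AddMonoidHom.id G') e hT (map_id_le hTP) hP, Category.assoc,
    chartInclusion_chartι R Δ' hTP, ← Category.assoc,
    chartMap_comp R (AddMonoidHom.id G) φ (AddMonoidHom.comp_id φ).symm (map_id_le hPQ) hQ hP',
    ← chartMap_comp R φ (AddMonoidHom.id G') e hT (map_id_le hTQ) hP', Category.assoc,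
    chartInclusion_chartι R Δ' hTQ]

/-- A cone of `Δ'` containing `φ(P)`. -/
def FanHom.target {Δ : Fan G} {Δ' : Fan G'} (φ : FanHom Δ Δ') (P : Δ.cones) : Δ'.cones :=
  ⟨(φ.exists_map_le P.1 P.2).choose, (φ.exists_map_le P.1 P.2).choose_spec.1⟩

theorem FanHom.map_le_target {Δ : Fan G} {Δ' : Fan G'} (φ : FanHom Δ Δ') (P : Δ.cones) :
    P.1.map φ.toAddMonoidHom ≤ (φ.target P).1 :=
  (φ.exists_map_le P.1 P.2).choose_spec.2

/-- The restriction of `φ_*` to the chart `U_P`: the composite `U_P ⟶ U_{P'} ⟶ X_{Δ'}` for some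
`P'` in `Δ'` containing `φ(P)`. -/
def toricMapOn [Module.Free ℤ G'] {Δ : Fan G} {Δ' : Fan G'} (φ : FanHom Δ Δ') (P : Δ.cones) :
    chart R P.1 ⟶ toricScheme R Δ' :=
  chartMap R φ.toAddMonoidHom (φ.map_le_target P) ≫ chartι R Δ' (φ.target P)

/-- `toricMapOn` does not depend on the choice of `P'`. -/
theorem toricMapOn_eq [Module.Free ℤ G'] {Δ : Fan G} {Δ' : Fan G'} (φ : FanHom Δ Δ') (P : Δ.cones)
    (P' : Δ'.cones) (h : P.1.map φ.toAddMonoidHom ≤ P'.1) :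
    toricMapOn R φ P = chartMap R φ.toAddMonoidHom h ≫ chartι R Δ' P' := by
  have h0 := chartMap_chartι_eq (R := R) φ.toAddMonoidHom (le_refl P.1) (φ.map_le_target P) h
  rw [chartInclusion, chartMap_id, Category.id_comp] at h0
  exact h0.symm

theorem chartInclusion_toricMapOn [Module.Free ℤ G'] {Δ : Fan G} {Δ' : Fan G'} (φ : FanHom Δ Δ')
    {P Q : Δ.cones} (h : P.1 ≤ Q.1) :
    chartInclusion R h ≫ toricMapOn R φ Q = toricMapOn R φ P :=
  chartMap_chartι_eq φ.toAddMonoidHom h (φ.map_le_target P) (φ.map_le_target Q)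

/-- The morphism of toric schemes `φ_*` induced by a homomorphism of fans `φ`. -/
def toricMap [Module.Free ℤ G] [Module.Free ℤ G'] {Δ : Fan G} {Δ' : Fan G'} (φ : FanHom Δ Δ') :
    toricScheme R Δ ⟶ toricScheme R Δ' :=
  colimit.desc (diagram R Δ)
    { pt := toricScheme R Δ'
      ι :=
        { app := toricMapOn R φ
          naturality := fun _ _ f =>
            (chartInclusion_toricMapOn R φ (leOfHom f)).trans (Category.comp_id _).symm } }

theorem chartι_toricMap [Module.Free ℤ G] [Module.Free ℤ G'] {Δ : Fan G} {Δ' : Fan G'}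
    (φ : FanHom Δ Δ') (P : Δ.cones) (P' : Δ'.cones) (h : P.1.map φ.toAddMonoidHom ≤ P'.1) :
    chartι R Δ P ≫ toricMap R φ = chartMap R φ.toAddMonoidHom h ≫ chartι R Δ' P' := by
  rw [← toricMapOn_eq]
  exact colimit.ι_desc _ _

end ToricScheme

/-- A morphism of schemes `f : X ⟶ Y` is birational if it restricts to an isomorphism from a dense
open subscheme of `X` onto a dense open subscheme of `Y`. -/
def IsBirational {X Y : Scheme.{u}} (f : X ⟶ Y) : Prop :=
  ∃ e : Scheme.PartialIso X Y, e.iso.hom ≫ e.target.ι = e.source.ι ≫ f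

end Toric

end

noncomputable section

namespace Toric

/-! ### Monoid algebras of dual cones and their fractions -/

section Algebra

/-! Every fan contains the zero cone, whose dual cone is all of `Module.Dual ℤ G`. So the toric
scheme contains the torus `Spec k[G*]` as an open subscheme. It is dense, since it meets every
irreducible chart. A homomorphism of fans sends the zero cone to the zero cone, so `φ_*` restricts
to the morphism of tori given by the dual map of `φ`, and both directions are read off from this
square (`chartι_toricMap`).

If `φ` is bijective, so is its dual; the tori are then isomorphic dense open subschemes
(`isBirational_of_isDominant`).

Conversely, a birational morphism induces an isomorphism on the stalk at the generic point of the
torus. Hence `k[G'*] → k[G*]` is injective and every element of `k[G*]` is a fraction of images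
(`injective_and_exists_mul_eq_of_isBirational`). Applied to monomials and compared on supports, this
makes `G'* → G*` injective and writes each `σ` as a difference of images
(`injective_and_exists_add_eq_of_mapDomainRingHom`). The image is a subgroup, so the dual map is
bijective, and reflexivity of free groups of finite rank gives `φ` back
(`bijective_of_bijective_dualMap`). -/

theorem uniqueSums_dualCone {G : Type u} [AddCommGroup G] (P : AddSubmonoid G) :
    UniqueSums (dualCone P) :=
  UniqueSums.of_injective_addHom
    ({ toFun := fun σ x => σ.1 x, map_add' := fun _ _ => rfl } : dualCone P →ₙ+ (G → ℤ))
    (fun _ _ h => Subtype.ext (LinearMap.ext fun x => congrFun h x)) inferInstance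

/-- Two nonempty finite supports have a pair whose sum is attained only once. The coefficient there
is a product of nonzero scalars, so the product of the two elements is nonzero. -/
theorem isDomain_addMonoidAlgebra_dualCone {G : Type u} [AddCommGroup G] (k : Type u) [Field k]
    (P : AddSubmonoid G) : IsDomain (AddMonoidAlgebra k (dualCone P)) :=
  have := uniqueSums_dualCone P
  have : NoZeroDivisors (AddMonoidAlgebra k (dualCone P)) := inferInstance
  NoZeroDivisors.to_isDomain _

/-- If the local homomorphism induced by `f : A → B` at the zero ideal of `B` is bijective, then
`f` is injective and every element of `B` is a fraction of elements of `f(A)`. -/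
theorem injective_and_exists_mul_eq_of_bijective_localRingHom {A B : Type*} [CommRing A]
    [CommRing B] [IsDomain A] [IsDomain B] (f : A →+* B) (I : Ideal A) [I.IsPrime]
    (h : I = Ideal.comap f ⊥) (hf : Function.Bijective (Localization.localRingHom I ⊥ f h)) :
    Function.Injective f ∧ ∀ c : B, ∃ a b : A, f b ≠ 0 ∧ c * f b = f a := by
  -- `I` is the kernel of `f`, not yet known to be zero. Being prime in a domain is enough for its
  -- complement to avoid zero divisors.
  have hI : I.primeCompl ≤ nonZeroDivisors A :=
    le_nonZeroDivisors_of_noZeroDivisors fun h => h I.zero_mem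
  have hB : (⊥ : Ideal B).primeCompl ≤ nonZeroDivisors B :=
    le_nonZeroDivisors_of_noZeroDivisors fun h => h (Ideal.zero_mem _)
  constructor
  · rw [injective_iff_map_eq_zero]
    intro a ha
    have h1 := Localization.localRingHom_to_map I ⊥ f h a
    rw [ha, map_zero, map_eq_zero_iff _ hf.1] at h1
    exact (IsLocalization.to_map_eq_zero_iff (Localization.AtPrime I) hI).mp h1
  · intro c
    obtain ⟨z, hz⟩ := hf.2 (algebraMap B _ c)
    obtain ⟨a, b, rfl⟩ := IsLocalization.exists_mk'_eq I.primeCompl z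
    -- The preimage of `c / 1` is `a / b` with `b ∉ I = ker f`, so `f b ≠ 0`; clearing denominators
    -- gives `c * f b = f a`.
    refine ⟨a, b, fun hb => b.2 ?_, ?_⟩
    · refine h.symm.le (Ideal.mem_comap.mpr ?_)
      rw [hb]
      exact Ideal.zero_mem _
    · apply IsLocalization.injective (Localization.AtPrime (⊥ : Ideal B)) hB
      rw [map_mul, ← hz, ← Localization.localRingHom_to_map I ⊥ f h,
        ← Localization.localRingHom_to_map I ⊥ f h, ← map_mul, IsLocalization.mk'_spec]

theorem mem_range_of_coeff_mapDomain_ne_zero {k M N : Type*} [Semiring k]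
    (f : M → N) {a : AddMonoidAlgebra k M} {n : N} (h : (a.mapDomain f).coeff n ≠ 0) :
    n ∈ Set.range f := by
  by_contra hn
  exact h (Finsupp.mapDomain_of_notMem_range a.coeff n hn)

/-- If `k[M] → k[N]` is injective and every element of `k[N]` is a fraction of elements of the
image, then `M → N` is injective and every element of `N` is a difference of elements of the
image. -/
theorem injective_and_exists_add_eq_of_mapDomainRingHom {k M N : Type*} [Field k]
    [AddCommMonoid M] [AddCommMonoid N]
    [IsCancelAdd N] (f : M →+ N)
    (hinj : Function.Injective (AddMonoidAlgebra.mapDomainRingHom k f))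
    (hfrac : ∀ c, ∃ a b, AddMonoidAlgebra.mapDomainRingHom k f b ≠ 0 ∧
      c * AddMonoidAlgebra.mapDomainRingHom k f b = AddMonoidAlgebra.mapDomainRingHom k f a) :
    Function.Injective f ∧ ∀ σ, ∃ l m, σ + f m = f l := by
  constructor
  · intro σ τ hστ
    have : AddMonoidAlgebra.single σ (1 : k) = AddMonoidAlgebra.single τ 1 := by
      apply hinj
      simp [AddMonoidAlgebra.mapDomain_single, hστ]
    exact AddMonoidAlgebra.single_left_injective one_ne_zero this
  · intro σ
    obtain ⟨a, b, hb, h⟩ := hfrac (AddMonoidAlgebra.single σ 1)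
    simp only [AddMonoidAlgebra.mapDomainRingHom_apply] at hb h
    -- Any exponent in the support of the denominator will do: multiplying by the monomial `σ`
    -- translates supports by `σ`, without merging terms because `N` is cancellative.
    obtain ⟨μ, hμ⟩ : ∃ μ, (b.mapDomain f).coeff μ ≠ 0 := by
      by_contra! hcon
      exact hb (AddMonoidAlgebra.ext (Finsupp.ext hcon))
    obtain ⟨m, rfl⟩ := mem_range_of_coeff_mapDomain_ne_zero f hμ
    have hσ : (a.mapDomain f).coeff (σ + f m) ≠ 0 := by
      rw [← h]
      simpa using hμ
    obtain ⟨l, hl⟩ := mem_range_of_coeff_mapDomain_ne_zero f hσ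
    exact ⟨l, m, hl.symm⟩

/-- The double dual of `f` is bijective, and naturality of evaluation identifies it with `f` for
reflexive modules. -/
theorem bijective_of_bijective_dualMap {R M N : Type*} [CommRing R] [AddCommGroup M]
    [AddCommGroup N] [Module R M] [Module R N] [Module.IsReflexive R M] [Module.IsReflexive R N]
    (f : M →ₗ[R] N) (hf : Function.Bijective f.dualMap) : Function.Bijective f := by
  have h : Function.Bijective (f.dualMap.dualMap ∘ₗ Module.Dual.eval R M) :=
    (LinearEquiv.ofBijective _ hf).dualMap.bijective.comp (Module.bijective_dual_eval R M)
  rw [Module.Dual.eval_naturality] at h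
  exact (Function.Bijective.of_comp_iff' (Module.bijective_dual_eval R N) f).mp h

end Algebra

/-! ### Birational morphisms, stalks and generic points -/

section Schemes

theorem isIso_stalkMap_of_comp {X Y Z : Scheme.{u}} (f : X ⟶ Y) (g : Y ⟶ Z) [IsOpenImmersion g]
    (x : X) (h : IsIso ((f ≫ g).stalkMap x)) : IsIso (f.stalkMap x) := by
  rw [Scheme.Hom.stalkMap_comp] at h
  exact (isIso_comp_left_iff (g.stalkMap (f x)) (f.stalkMap x)).mp h

theorem isIso_stalkMap_comp_iff {X Y Z : Scheme.{u}} (f : X ⟶ Y) (g : Y ⟶ Z) [IsOpenImmersion f]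
    (x : X) : IsIso ((f ≫ g).stalkMap x) ↔ IsIso (g.stalkMap (f x)) := by
  rw [Scheme.Hom.stalkMap_comp]
  exact isIso_comp_right_iff _ _

/-- Take for `W` the preimage of the source of the partial isomorphism: density makes it meet the
image of `T`, and on that source `f` is an open immersion. -/
theorem exists_isIso_stalkMap_of_isBirational {X Y T : Scheme.{u}} {f : X ⟶ Y}
    (hf : IsBirational f) (i : T ⟶ X) [IsOpenImmersion i] [Nonempty T] :
    ∃ W : T.Opens, (W : Set T).Nonempty ∧ ∀ x ∈ W, IsIso ((i ≫ f).stalkMap x) := by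
  obtain ⟨e, he⟩ := hf
  refine ⟨i ⁻¹ᵁ e.source, ?_, fun x (hx : i x ∈ e.source) => ?_⟩
  · obtain ⟨_, hU, x, rfl⟩ := e.dense_source.inter_open_nonempty _ i.isOpenEmbedding.isOpen_range
      (Set.range_nonempty i) |>.imp fun _ h => And.symm h
    exact ⟨x, hU⟩
  -- By `he`, this composite is an isomorphism followed by the inclusion of an open subscheme.
  · have h1 : IsOpenImmersion (e.source.ι ≫ f) := he ▸ inferInstance
    have h2 (y : e.source.toScheme) : IsIso ((e.source.ι ≫ f).stalkMap y) := inferInstance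
    exact (isIso_stalkMap_comp_iff i f x).mpr
      ((isIso_stalkMap_comp_iff e.source.ι f (⟨i x, hx⟩ : e.source.toScheme)).mp (h2 _))

theorem bijective_localRingHom_of_isIso_stalkMap {A B : CommRingCat.{u}} (f : A ⟶ B)
    (p : PrimeSpectrum B) (h : IsIso ((Spec.map f).stalkMap p)) :
    Function.Bijective (Localization.localRingHom (PrimeSpectrum.comap f.hom p).asIdeal p.asIdeal
      f.hom rfl) := by
  have := ((MorphismProperty.isomorphisms CommRingCat).arrow_mk_iso_iff
    (Scheme.arrowStalkMapSpecIso f p)).mp h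
  exact (ConcreteCategory.isIso_iff_bijective _).mp this

/-- If a birational morphism restricts to `Spec g` on open affines, for `g : A → B` a homomorphism of
domains, then `g` is injective and every element of `B` is a fraction of elements of `g(A)`. -/
theorem injective_and_exists_mul_eq_of_isBirational {X Y : Scheme.{u}} {f : X ⟶ Y}
    (hf : IsBirational f) {A B : CommRingCat.{u}} [IsDomain A] [IsDomain B] (g : A ⟶ B)
    (i : Spec B ⟶ X) (j : Spec A ⟶ Y) [IsOpenImmersion i] [IsOpenImmersion j]
    (h : i ≫ f = Spec.map g ≫ j) :
    Function.Injective g.hom ∧ ∀ c : B, ∃ a b : A, g.hom b ≠ 0 ∧ c * g.hom b = g.hom a := by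
  have : Nonempty (Spec B) := inferInstanceAs (Nonempty (PrimeSpectrum B))
  obtain ⟨W, ⟨x, hx⟩, hW⟩ := exists_isIso_stalkMap_of_isBirational hf i
  let η : Spec B := (⊥ : PrimeSpectrum B)
  -- The generic point specializes to every point, so it lies in every nonempty open set.
  have hη : η ∈ W := by
    have : η ⤳ x := (PrimeSpectrum.le_iff_specializes (⊥ : PrimeSpectrum B) x).mp bot_le
    exact this.mem_open W.isOpen hx
  have h1 := hW η hη
  rw [h] at h1
  exact injective_and_exists_mul_eq_of_bijective_localRingHom g.hom _ rfl
    (bijective_localRingHom_of_isIso_stalkMap g ⊥ (isIso_stalkMap_of_comp _ j η h1))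

theorem isBirational_of_isDominant {X Y T T' : Scheme.{u}} (f : X ⟶ Y) (g : T ⟶ T') [IsIso g]
    (i : T ⟶ X) (j : T' ⟶ Y) [IsOpenImmersion i] [IsOpenImmersion j] [IsDominant i] [IsDominant j]
    (h : i ≫ f = g ≫ j) : IsBirational f :=
  ⟨{ source := i.opensRange
     dense_source := i.denseRange
     target := j.opensRange
     dense_target := j.denseRange
     iso := i.isoOpensRange.symm ≪≫ asIso g ≪≫ j.isoOpensRange }, by simp [← h]⟩

end Schemes

/-! ### The dense torus of a toric scheme -/

section Torus

variable {G G' : Type u} [AddCommGroup G] [AddCommGroup G']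

/-- Sharpness is exactly what makes the nonzero elements of `P` a prime ideal. -/
theorem IsConvexCone.isFace_bot {P : AddSubmonoid G} (hP : IsConvexCone P) : IsFace ⊥ P := by
  refine ⟨(P : Set G) \ {0}, ⟨Set.sdiff_subset, ?_, by simp, ?_⟩, ?_⟩
  · rintro x hx y ⟨hy, hy0⟩
    refine ⟨P.add_mem hx hy, fun h => hy0 (hP.sharp y hy ?_)⟩
    rwa [neg_eq_of_add_eq_zero_left h]
  · rintro x hx y hy ⟨-, h⟩
    by_contra! hcon
    have hx0 : x = 0 := by_contra fun h => hcon.1 ⟨hx, h⟩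
    have hy0 : y = 0 := by_contra fun h => hcon.2 ⟨hy, h⟩
    exact h (by simp [hx0, hy0])
  · ext x
    simp only [AddSubmonoid.coe_bot, Set.mem_singleton_iff, Set.mem_sdiff, SetLike.mem_coe, not_and,
      not_not]
    exact ⟨fun h => ⟨h ▸ P.zero_mem, fun _ => h⟩, fun h => h.2 h.1⟩

theorem Fan.bot_mem (Δ : Fan G) : ⊥ ∈ Δ.cones := by
  obtain ⟨P, hP⟩ := Δ.nonempty
  exact Δ.face_mem P hP ⊥ (Δ.isConvexCone P hP).isFace_bot

theorem map_bot_le (φ : G →+ G') : (⊥ : AddSubmonoid G).map φ ≤ ⊥ :=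
  (AddSubmonoid.map_bot φ).le

theorem mem_dualCone_bot (σ : Module.Dual ℤ G) : σ ∈ dualCone (⊥ : AddSubmonoid G) := by
  rintro x rfl
  simp

/-- Nonnegativity on the zero cone is no condition, so both maps are precomposition with `φ` on the
full dual groups. -/
theorem bijective_dualConeMap_bot_iff (φ : G →+ G') :
    Function.Bijective (dualConeMap φ (map_bot_le φ)) ↔
      Function.Bijective φ.toIntLinearMap.dualMap := by
  let e (H : Type u) [AddCommGroup H] : dualCone (⊥ : AddSubmonoid H) ≃ Module.Dual ℤ H :=
    Equiv.subtypeUnivEquiv mem_dualCone_bot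
  have : φ.toIntLinearMap.dualMap ∘ e G' = e G ∘ dualConeMap φ (map_bot_le φ) := rfl
  rw [← Function.Bijective.of_comp_iff' (e G).bijective, ← this,
    Function.Bijective.of_comp_iff _ (e G').bijective]

instance isOpenImmersion_chartι [Module.Free ℤ G] (R : Type u) [CommRing R] (Δ : Fan G)
    (P : Δ.cones) : IsOpenImmersion (chartι R Δ P) :=
  inferInstanceAs (IsOpenImmersion (colimit.ι (diagram R Δ) P))

variable (k : Type u) [Field k]

instance irreducibleSpace_chart (P : AddSubmonoid G) : IrreducibleSpace (chart k P) :=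
  have := isDomain_addMonoidAlgebra_dualCone k P
  inferInstanceAs (IrreducibleSpace (PrimeSpectrum (AddMonoidAlgebra k (dualCone P))))

theorem isDominant_chartι_bot [Module.Free ℤ G] (Δ : Fan G) :
    IsDominant (chartι k Δ ⟨⊥, Δ.bot_mem⟩) := by
  refine ⟨dense_iff_inter_open.mpr ?_⟩
  rintro V hV ⟨x, hx⟩
  obtain ⟨P, y, rfl⟩ := Scheme.IsLocallyDirected.ι_jointly_surjective (diagram k Δ) x
  have hP := Δ.isConvexCone P.1 P.2
  have := isOpenImmersion_chartInclusion (R := k) hP.fg hP.isFace_bot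
  -- In the irreducible chart `U_P`, the trace of `V` and the torus are nonempty open sets, so they
  -- meet.
  obtain ⟨_, hz, w, rfl⟩ := nonempty_preirreducible_inter (hV.preimage (chartι k Δ P).continuous)
    (chartInclusion k hP.isFace_bot.le).isOpenEmbedding.isOpen_range ⟨y, hx⟩
    (Set.range_nonempty _)
  refine ⟨_, hz, w, ?_⟩
  rw [← Scheme.Hom.comp_apply, chartInclusion_chartι k Δ (P := ⟨⊥, Δ.bot_mem⟩)]

theorem isIso_chartMap (φ : G →+ G') {P : AddSubmonoid G} {P' : AddSubmonoid G'}
    (h : P.map φ ≤ P') (hφ : Function.Bijective (dualConeMap φ h)) : IsIso (chartMap k φ h) := by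
  let e := AddMonoidAlgebra.mapDomainRingEquiv k (AddEquiv.ofBijective _ hφ)
  have : chartMap k φ h = Spec.map e.toCommRingCatIso.hom := rfl
  rw [this]
  infer_instance

end Torus

end Toric

end

theorem mainTheorem6 (k : Type u) [Field k]
    {G : Type u} [AddCommGroup G] [Module.Free ℤ G] [Module.Finite ℤ G]
    {G' : Type u} [AddCommGroup G'] [Module.Free ℤ G'] [Module.Finite ℤ G']
    (Δ : Toric.Fan G) (Δ' : Toric.Fan G') (φ : Toric.FanHom Δ Δ') :
    Toric.IsBirational (Toric.toricMap k φ) ↔ Function.Bijective φ.toAddMonoidHom := by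
  have hsq := Toric.chartι_toricMap k φ ⟨⊥, Δ.bot_mem⟩ ⟨⊥, Δ'.bot_mem⟩
    (Toric.map_bot_le φ.toAddMonoidHom)
  constructor
  · intro h
    have := Toric.isDomain_addMonoidAlgebra_dualCone k (⊥ : AddSubmonoid G)
    have := Toric.isDomain_addMonoidAlgebra_dualCone k (⊥ : AddSubmonoid G')
    obtain ⟨h1, h2⟩ := Toric.injective_and_exists_mul_eq_of_isBirational h _ _ _ hsq
    have h3 : Function.Bijective (Toric.dualConeMap _ (Toric.map_bot_le φ.toAddMonoidHom)) := by
      obtain ⟨hinj, hsurj⟩ := Toric.injective_and_exists_add_eq_of_mapDomainRingHom _ h1 h2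
      refine ⟨hinj, fun σ => ?_⟩
      obtain ⟨l, m, hlm⟩ := hsurj σ
      -- The dual cone of the zero cone is typed only as a monoid, so the negative of `m` is built
      -- by hand to turn `σ + f m = f l` into `σ = f (l - m)`.
      have hm : m + ⟨-m.1, Toric.mem_dualCone_bot _⟩ = 0 := Subtype.ext (add_neg_cancel m.1)
      refine ⟨l + ⟨-m.1, Toric.mem_dualCone_bot _⟩, ?_⟩
      rw [map_add, ← hlm, add_assoc, ← map_add, hm, map_zero, add_zero]
    exact Toric.bijective_of_bijective_dualMap _ ((Toric.bijective_dualConeMap_bot_iff _).mp h3)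
  · intro h
    have := Toric.isDominant_chartι_bot k Δ
    have := Toric.isDominant_chartι_bot k Δ'
    have := Toric.isIso_chartMap k φ.toAddMonoidHom (Toric.map_bot_le _)
      ((Toric.bijective_dualConeMap_bot_iff _).mpr
        (LinearEquiv.ofBijective φ.toAddMonoidHom.toIntLinearMap h).dualMap.bijective)
    exact Toric.isBirational_of_isDominant _ _ _ _ hsq
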